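/- There exist a $C^\infty$ function $W:\mathbb{R}^2\to\mathbb{R}$, a $C^\infty$ curve $u:\mathbb{R}\to\mathbb{R}^2$ and a number $T>0$ with the following properties, where $a^{\pm}=(\pm 2,0)$. (a) $W(a^{+})=W(a^-)=0$ and $W(p)>0$ for every $p\in\mathbb{R}^2\setminus\{a^+,a^-\}$; the Hessian matrices $D^2W(a^{+})$ and $D^2W(a^-)$ are positive definite; and $W$ is symmetric with respect to the coordinate axes, that is, $W(-p_1,p_2)=W(p_1,p_2)=W(p_1,-p_2)$ for all $p_1,p_2\in\mathbb{R}$. (b) $u''(x)=\nabla W(u(x))$ and $u(x+T)=u(x)$ for all $x\in\mathbb{R}$; $u(0)=a^+$ and $u(T/2)=a^-$; and $u'(0)\neq 0$, $u'(T/2)\neq 0$. (c) $u$ violates the Modica estimate $\frac12|u'(x)|^2\le W(u(x))$ for all $x\in\mathbb{R}$: indeed $\frac12|u'(x)|^2> W(u(x))$ for $x=0$ and for $x=T/2$. (d) $u$ violates the Liouville type theorem: $u$ is bounded and not constant, although $W(u(0))=0$. Thus it is false for this $W$ that every bounded ($C^\infty$) solution $v:\mathbb{R}\to\mathbb{R}^2$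 of $v''=\nabla W(v)$ with $W(v(x_0))=0$ for some $x_0\in\mathbb{R}$ is constant. -/

import Mathlib

open scoped ContDiff Gradient

noncomputable section

/-- The Euclidean plane. -/
abbrev Plane : Type := EuclideanSpace ℝ (Fin 2)

/-- The well `a⁺ = (2, 0)`. -/
def wellPlus : Plane := !₂[2, 0]

/-- The well `a⁻ = (-2, 0)`. -/
def wellMinus : Plane := !₂[-2, 0]

/-- The Hessian matrix `D²W(p)`, whose `(i, j)` entry is the second derivative of `W` at `p`
in the coordinate directions `eᵢ`, `eⱼ`. -/
def hessianMatrix (W : Plane → ℝ) (p : Plane) : Matrix (Fin 2) (Fin 2) ℝ :=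
  Matrix.of fun i j =>
    fderiv ℝ (fderiv ℝ W) p (EuclideanSpace.single i 1) (EuclideanSpace.single j 1)

/-- `W` is a smooth double well potential on the plane: it vanishes exactly at `a⁺` and `a⁻`,
is positive elsewhere, has positive definite Hessian at both zeros, and is symmetric with
respect to both coordinate axes. -/
structure IsSymmetricDoubleWell (W : Plane → ℝ) : Prop where
  smooth : ContDiff ℝ ∞ W
  zero_plus : W wellPlus = 0
  zero_minus : W wellMinus = 0
  pos : ∀ p : Plane, p ≠ wellPlus → p ≠ wellMinus → 0 < W p
  hess_plus : (hessianMatrix W wellPlus).PosDef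
  hess_minus : (hessianMatrix W wellMinus).PosDef
  symm_fst : ∀ x y : ℝ, W !₂[-x, y] = W !₂[x, y]
  symm_snd : ∀ x y : ℝ, W !₂[x, -y] = W !₂[x, y]

/-- `u` is a smooth entire solution of `u'' = ∇W(u)`. -/
def IsEntireSolution (W : Plane → ℝ) (u : ℝ → Plane) : Prop :=
  ContDiff ℝ ∞ u ∧ ∀ x : ℝ, deriv (deriv u) x = ∇ W (u x)

/-- The Modica estimate for the curve `u` and the potential `W`. -/
def ModicaEstimate (W : Plane → ℝ) (u : ℝ → Plane) : Prop :=
  ∀ x : ℝ, (1 / 2 : ℝ) * ‖deriv u x‖ ^ 2 ≤ W (u x)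

/-- The Liouville type theorem for the potential `W`: a bounded entire solution along which `W`
vanishes at some point is constant. -/
def LiouvilleTheorem (W : Plane → ℝ) : Prop :=
  ∀ u : ℝ → Plane, IsEntireSolution W u → Bornology.IsBounded (Set.range u) →
    (∃ x₀ : ℝ, W (u x₀) = 0) → ∃ c : Plane, ∀ x : ℝ, u x = c

end

open Real

/-! The orbit is chosen first, and `W` is built around it. Its second coordinate is a strictly
increasing cubic in `s = sin t`, so `s` is a smooth function `cubicInv` of that coordinate, and the
trace lies in `G = 0` with `G = orbitEqn`. Put `W = Q(s) - R(s) G + G ^ 2`. On `G = 0` the equation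
`u'' = ∇W(u)` involves only `Q` and `R`: its first component forces `R = 9 s² / (2 (2 + s²))`, and
conservation of energy forces `Q = |u'|² / 2 - 9 / 32`, where `9 / 32` is the kinetic energy at the
wells. The term `G ^ 2` then makes `W` positive off the wells (`potentialAux_pos`). The orbit
crosses both wells with nonzero speed, which refutes both statements. -/

/-! ### Inverting the cubic. -/

/-- The smooth odd inverse of `s ↦ (3 s + 4 s³) / 4`, in closed form. -/
noncomputable def cubicInv (y : ℝ) : ℝ := sinh (arsinh (4 * y) / 3)

/-- This is `sinh (3 a) = 4 sinh a ^ 3 + 3 sinh a`. -/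
lemma cubicInv_spec (y : ℝ) : (3 * cubicInv y + 4 * cubicInv y ^ 3) / 4 = y := by
  have h := sinh_three_mul (arsinh (4 * y) / 3)
  rw [mul_div_cancel₀ _ (three_ne_zero), sinh_arsinh] at h
  unfold cubicInv
  linarith

lemma cubicInv_cubic (s : ℝ) : cubicInv ((3 * s + 4 * s ^ 3) / 4) = s := by
  have h := cubicInv_spec ((3 * s + 4 * s ^ 3) / 4)
  set r := cubicInv ((3 * s + 4 * s ^ 3) / 4)
  have h' : (r - s) * (3 + 4 * (r ^ 2 + r * s + s ^ 2)) = 0 := by linear_combination 4 * h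
  rcases mul_eq_zero.mp h' with h' | h'
  · linarith
  · nlinarith [sq_nonneg (r + s), sq_nonneg r, sq_nonneg s]

lemma cubicInv_zero : cubicInv 0 = 0 := by simp [cubicInv]

lemma cubicInv_neg (y : ℝ) : cubicInv (-y) = -cubicInv y := by
  simp [cubicInv, neg_div]

lemma eq_zero_of_cubicInv_eq_zero {y : ℝ} (h : cubicInv y = 0) : y = 0 := by
  simpa [h] using (cubicInv_spec y).symm

lemma contDiff_cubicInv : ContDiff ℝ ∞ cubicInv :=
  contDiff_sinh.comp (((contDiff_arsinh).comp (contDiff_const.mul contDiff_id)).div_const 3)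

lemma hasDerivAt_cubicInv (y : ℝ) :
    HasDerivAt cubicInv (4 / (3 * (1 + 4 * cubicInv y ^ 2))) y := by
  have hd : HasDerivAt cubicInv (deriv cubicInv y) y :=
    (contDiff_cubicInv.differentiable (by simp) y).hasDerivAt
  have h1 := (((hd.const_mul 3).add ((hd.pow 3).const_mul 4)).div_const 4)
  have h2 : HasDerivAt (fun z : ℝ => z) 1 y := hasDerivAt_id y
  have h3 := h1.unique (h2.congr_of_eventuallyEq
    (Filter.Eventually.of_forall fun z => by simpa using cubicInv_spec z))
  have h4 : deriv cubicInv y = 4 / (3 * (1 + 4 * cubicInv y ^ 2)) := by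
    rw [eq_div_iff (by positivity)]
    norm_num at h3
    linear_combination 4 * h3
  rwa [h4] at hd

/-! ### The potential and its derivatives. -/

/-- A function vanishing on the trace of `orbit`. -/
noncomputable def orbitEqn (x s : ℝ) : ℝ := x ^ 2 - (1 - s ^ 2) * (2 + s ^ 2) ^ 2

/-- The potential, in terms of the first coordinate and of `cubicInv` of the second one. -/
noncomputable def potentialAux (x s : ℝ) : ℝ :=
  9 / 32 * s ^ 2 * (7 + 8 * s ^ 2) - 9 * s ^ 2 / (2 * (2 + s ^ 2)) * orbitEqn x s
    + orbitEqn x s ^ 2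

/-- The double well potential. -/
noncomputable def potential (p : Plane) : ℝ := potentialAux (p 0) (cubicInv (p 1))

/-- The partial derivative of `potential` in the first direction. -/
noncomputable def potentialFst (p : Plane) : ℝ :=
  2 * p 0 * (2 * orbitEqn (p 0) (cubicInv (p 1))
    - 9 * cubicInv (p 1) ^ 2 / (2 * (2 + cubicInv (p 1) ^ 2)))

/-- The quotient of the second partial derivative of `potential` by `cubicInv`. -/
noncomputable def potentialSndQuot (p : Plane) : ℝ :=
  4 / (3 * (1 + 4 * cubicInv (p 1) ^ 2)) *
    (9 / 32 * (14 + 32 * cubicInv (p 1) ^ 2)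
      - 18 / (2 + cubicInv (p 1) ^ 2) ^ 2 * orbitEqn (p 0) (cubicInv (p 1))
      - 27 * cubicInv (p 1) ^ 4
      + 12 * cubicInv (p 1) ^ 2 * (2 + cubicInv (p 1) ^ 2)
        * orbitEqn (p 0) (cubicInv (p 1)))

lemma contDiff_coord (i : Fin 2) : ContDiff ℝ ∞ (fun p : Plane => p i) :=
  (EuclideanSpace.proj (𝕜 := ℝ) i : Plane →L[ℝ] ℝ).contDiff

lemma contDiff_cubicInv_snd : ContDiff ℝ ∞ (fun p : Plane => cubicInv (p 1)) :=
  contDiff_cubicInv.comp (contDiff_coord 1)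

lemma contDiff_orbitEqn :
    ContDiff ℝ ∞ (fun p : Plane => orbitEqn (p 0) (cubicInv (p 1))) := by
  have h0 := contDiff_coord 0
  have h1 := contDiff_cubicInv_snd
  unfold orbitEqn
  fun_prop

lemma contDiff_potential : ContDiff ℝ ∞ potential := by
  have h1 := contDiff_cubicInv_snd
  have h2 := contDiff_orbitEqn
  unfold potential potentialAux
  fun_prop (disch := intros; positivity)

lemma contDiff_potentialSndQuot : ContDiff ℝ ∞ potentialSndQuot := by
  have h1 := contDiff_cubicInv_snd
  have h2 := contDiff_orbitEqn
  unfold potentialSndQuot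
  fun_prop (disch := intros; positivity)

lemma hasFDerivAt_coord (i : Fin 2) (p : Plane) :
    HasFDerivAt (fun p : Plane => p i) (EuclideanSpace.proj (𝕜 := ℝ) i : Plane →L[ℝ] ℝ) p :=
  (EuclideanSpace.proj (𝕜 := ℝ) i : Plane →L[ℝ] ℝ).hasFDerivAt

lemma hasFDerivAt_cubicInv_snd (p : Plane) :
    HasFDerivAt (fun p : Plane => cubicInv (p 1))
      ((4 / (3 * (1 + 4 * cubicInv (p 1) ^ 2))) •
        (EuclideanSpace.proj (𝕜 := ℝ) 1 : Plane →L[ℝ] ℝ)) p :=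
  HasDerivAt.comp_hasFDerivAt (h₂ := cubicInv) (f := fun p : Plane => p 1) p
    (hasDerivAt_cubicInv (p 1)) (hasFDerivAt_coord 1 p)

lemma hasFDerivAt_orbitEqn (p : Plane) :
    HasFDerivAt (fun p : Plane => orbitEqn (p 0) (cubicInv (p 1)))
      ((2 * p 0) • (EuclideanSpace.proj (𝕜 := ℝ) 0 : Plane →L[ℝ] ℝ)
        + (6 * cubicInv (p 1) ^ 3 * (2 + cubicInv (p 1) ^ 2)) •
          ((4 / (3 * (1 + 4 * cubicInv (p 1) ^ 2))) •
            (EuclideanSpace.proj (𝕜 := ℝ) 1 : Plane →L[ℝ] ℝ))) p := by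
  have hx := (hasFDerivAt_coord 0 p).pow 2
  have hP : HasDerivAt (fun s : ℝ => (1 - s ^ 2) * (2 + s ^ 2) ^ 2)
      (-(6 * cubicInv (p 1) ^ 3 * (2 + cubicInv (p 1) ^ 2))) (cubicInv (p 1)) := by
    have hs := hasDerivAt_pow 2 (cubicInv (p 1))
    refine ((hs.const_sub 1).mul ((hs.const_add 2).pow 2)).congr_deriv ?_
    simp
    ring
  have h := hx.sub (hP.comp_hasFDerivAt p (hasFDerivAt_cubicInv_snd p))
  refine h.congr_fderiv ?_
  ext v
  simp

lemma hasFDerivAt_potential (p : Plane) :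
    HasFDerivAt potential
      (potentialFst p • (EuclideanSpace.proj (𝕜 := ℝ) 0 : Plane →L[ℝ] ℝ)
        + (cubicInv (p 1) * potentialSndQuot p) •
          (EuclideanSpace.proj (𝕜 := ℝ) 1 : Plane →L[ℝ] ℝ)) p := by
  set s := cubicInv (p 1) with hs_def
  have hQ : HasDerivAt (fun s : ℝ => 9 / 32 * s ^ 2 * (7 + 8 * s ^ 2))
      (9 / 32 * (14 * s + 32 * s ^ 3)) s := by
    have hs := hasDerivAt_pow 2 s
    refine ((hs.const_mul (9 / 32)).mul ((hs.const_mul 8).const_add 7)).congr_deriv ?_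
    simp
    ring
  have hR : HasDerivAt (fun s : ℝ => 9 * s ^ 2 / (2 * (2 + s ^ 2)))
      (18 * s / (2 + s ^ 2) ^ 2) s := by
    have hs := hasDerivAt_pow 2 s
    refine ((hs.const_mul 9).div ((hs.const_add 2).const_mul 2) (by positivity)).congr_deriv ?_
    simp
    field_simp
    ring
  have hS := hasFDerivAt_cubicInv_snd p
  have hG := hasFDerivAt_orbitEqn p
  have h := ((hQ.comp_hasFDerivAt p hS).sub ((hR.comp_hasFDerivAt p hS).mul hG)).add (hG.pow 2)
  refine h.congr_fderiv ?_
  ext v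
  simp only [← hs_def, potentialFst, potentialSndQuot, Function.comp_apply]
  have h1 : (1 + 4 * s ^ 2) ≠ 0 := by positivity
  have h2 : (2 + s ^ 2) ≠ 0 := by positivity
  simp
  field_simp
  ring

lemma gradient_potential (p : Plane) :
    ∇ potential p = !₂[potentialFst p, cubicInv (p 1) * potentialSndQuot p] := by
  refine HasGradientAt.gradient (hasGradientAt_iff_hasFDerivAt.mpr ?_)
  refine (hasFDerivAt_potential p).congr_fderiv ?_
  ext v
  simp [PiLp.inner_apply, Fin.sum_univ_two, mul_comm]

lemma hessianMatrix_potential {x : ℝ} (hx : x ^ 2 = 4) :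
    hessianMatrix potential !₂[x, 0] = Matrix.diagonal ![32, 7] := by
  set p : Plane := !₂[x, 0] with hp
  have hp0 : p 0 = x := rfl
  have hp1 : cubicInv (p 1) = 0 := cubicInv_zero
  have hG0 : orbitEqn (p 0) (cubicInv (p 1)) = 0 := by
    simp only [orbitEqn, hp0, hp1, hx]
    norm_num
  have hS := hasFDerivAt_cubicInv_snd p
  have hR : HasDerivAt (fun s : ℝ => 9 * s ^ 2 / (2 * (2 + s ^ 2))) 0 (cubicInv (p 1)) := by
    have hs := hasDerivAt_pow 2 (cubicInv (p 1))
    refine ((hs.const_mul 9).div ((hs.const_add 2).const_mul 2) (by positivity)).congr_deriv ?_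
    simp [hp1]
  have hA : HasFDerivAt potentialFst
      ((32 : ℝ) • (EuclideanSpace.proj (𝕜 := ℝ) 0 : Plane →L[ℝ] ℝ)) p := by
    have h := ((hasFDerivAt_coord 0 p).const_mul 2).mul
      (((hasFDerivAt_orbitEqn p).const_mul 2).sub (hR.comp_hasFDerivAt p hS))
    refine h.congr_fderiv ?_
    ext v
    rw [hp1, hp0] at hG0
    simp [hG0, hp1, hp0]
    linear_combination 8 * v 0 * hx
  have hB : HasFDerivAt (fun p : Plane => cubicInv (p 1) * potentialSndQuot p)
      ((7 : ℝ) • (EuclideanSpace.proj (𝕜 := ℝ) 1 : Plane →L[ℝ] ℝ)) p := by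
    -- The factor `cubicInv (p 1)` vanishes here, so only the value of `potentialSndQuot` at `p`
    -- matters, not its derivative.
    have h := hS.mul (contDiff_potentialSndQuot.differentiable (by simp) p).hasFDerivAt
    refine h.congr_fderiv ?_
    ext v
    rw [hp1] at hG0
    simp [potentialSndQuot, hG0, hp1]
    ring
  have hW : fderiv ℝ potential = fun p =>
      potentialFst p • (EuclideanSpace.proj (𝕜 := ℝ) 0 : Plane →L[ℝ] ℝ)
        + (cubicInv (p 1) * potentialSndQuot p) •
          (EuclideanSpace.proj (𝕜 := ℝ) 1 : Plane →L[ℝ] ℝ) :=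
    funext fun p => (hasFDerivAt_potential p).fderiv
  have h2 := (hA.smul_const (EuclideanSpace.proj (𝕜 := ℝ) 0 : Plane →L[ℝ] ℝ)).add
    (hB.smul_const (EuclideanSpace.proj (𝕜 := ℝ) 1 : Plane →L[ℝ] ℝ))
  ext i j
  unfold hessianMatrix
  rw [Matrix.of_apply, hW]
  erw [h2.fderiv]
  fin_cases i <;> fin_cases j <;> simp

/-! ### Positivity and the double well. -/

lemma potentialAux_pos {x s : ℝ} (h : s ≠ 0 ∨ x ^ 2 ≠ 4) : 0 < potentialAux x s := by
  rcases eq_or_ne s 0 with rfl | hs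
  · have hx : x ^ 2 - 4 ≠ 0 := sub_ne_zero.mpr (h.resolve_left (by simp))
    have : potentialAux x 0 = (x ^ 2 - 4) ^ 2 := by
      simp only [potentialAux, orbitEqn]
      ring
    rw [this]
    positivity
  · unfold potentialAux
    generalize orbitEqn x s = g
    have hσ : 0 < s ^ 2 := by positivity
    generalize s ^ 2 = σ at hσ
    set r := 9 * σ / (2 * (2 + σ)) with hr_def
    -- From `(2 + σ) ^ 2 ≥ 8 σ`. Completing the square in `g` leaves `Q - r ^ 2 / 4`, and `81 / 128
    -- < 63 / 32`.
    have hr : r ^ 2 ≤ 81 / 32 * σ := by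
      rw [hr_def, div_pow, div_le_iff₀ (by positivity)]
      nlinarith [mul_nonneg hσ.le (sq_nonneg (σ - 2))]
    nlinarith [sq_nonneg (g - r / 2), mul_pos hσ hσ]

lemma isSymmetricDoubleWell_potential : IsSymmetricDoubleWell potential where
  smooth := contDiff_potential
  zero_plus := by simp [potential, potentialAux, orbitEqn, wellPlus, cubicInv_zero]
  zero_minus := by simp [potential, potentialAux, orbitEqn, wellMinus, cubicInv_zero]
  pos p hp hm := by
    refine potentialAux_pos ?_
    by_contra! h
    have h1 := eq_zero_of_cubicInv_eq_zero h.1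
    have h0 : (p 0 - 2) * (p 0 + 2) = 0 := by linear_combination h.2
    rcases mul_eq_zero.mp h0 with h0 | h0
    · refine hp ?_
      ext i
      fin_cases i
      · simpa [wellPlus] using sub_eq_zero.mp h0
      · simpa [wellPlus] using h1
    · refine hm ?_
      ext i
      fin_cases i
      · simpa [wellMinus] using eq_neg_of_add_eq_zero_left h0
      · simpa [wellMinus] using h1
  hess_plus := by
    rw [wellPlus, hessianMatrix_potential (by norm_num)]
    exact Matrix.PosDef.diagonal fun i => by fin_cases i <;> simp
  hess_minus := by
    rw [wellMinus, hessianMatrix_potential (by norm_num)]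
    exact Matrix.PosDef.diagonal fun i => by fin_cases i <;> simp
  symm_fst x y := by simp [potential, potentialAux, orbitEqn]
  symm_snd x y := by simp [potential, potentialAux, orbitEqn, cubicInv_neg]

/-! ### The orbit and the equation of motion. -/

/-- The periodic orbit through both wells. -/
noncomputable def orbit (t : ℝ) : Plane := !₂[3 * cos t - cos t ^ 3, (3 * sin t + 4 * sin t ^ 3) / 4]

lemma hasDerivAt_plane {f g : ℝ → ℝ} {a b t : ℝ} (hf : HasDerivAt f a t)
    (hg : HasDerivAt g b t) : HasDerivAt (fun t => (!₂[f t, g t] : Plane)) !₂[a, b] t := by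
  rw [hasDerivAt_iff_hasFDerivAt, ← hasFDerivWithinAt_univ, hasFDerivWithinAt_euclidean]
  intro i
  rw [hasFDerivWithinAt_univ]
  fin_cases i
  · refine hf.hasFDerivAt.congr_fderiv ?_
    ext
    simp
  · refine hg.hasFDerivAt.congr_fderiv ?_
    ext
    simp

lemma deriv_orbit :
    deriv orbit = fun t => !₂[-3 * sin t ^ 3, 3 / 4 * (cos t * (1 + 4 * sin t ^ 2))] := by
  funext t
  refine (hasDerivAt_plane (a := -3 * sin t ^ 3) ?_ ?_).deriv
  · refine (((hasDerivAt_cos t).const_mul 3).sub ((hasDerivAt_cos t).pow 3)).congr_deriv ?_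
    simp
    linear_combination 3 * sin t * sin_sq_add_cos_sq t
  · refine ((((hasDerivAt_sin t).const_mul 3).add
      (((hasDerivAt_sin t).pow 3).const_mul 4)).div_const 4).congr_deriv ?_
    simp
    ring

lemma deriv_deriv_orbit (t : ℝ) :
    deriv (deriv orbit) t =
      !₂[-9 * sin t ^ 2 * cos t, 3 / 4 * (7 * sin t - 12 * sin t ^ 3)] := by
  rw [deriv_orbit]
  refine (hasDerivAt_plane ?_ ?_).deriv
  · refine (((hasDerivAt_sin t).pow 3).const_mul (-3)).congr_deriv ?_
    simp
    ring
  · refine (((hasDerivAt_cos t).mul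
      ((((hasDerivAt_sin t).pow 2).const_mul 4).const_add 1)).const_mul (3 / 4)).congr_deriv ?_
    simp
    linear_combination 8 * sin t * sin_sq_add_cos_sq t

lemma contDiff_orbit : ContDiff ℝ ∞ orbit := by
  rw [contDiff_euclidean]
  intro i
  fin_cases i
  · simp only [orbit]
    exact (contDiff_const.mul contDiff_cos).sub (contDiff_cos.pow 3)
  · simp only [orbit]
    exact ((contDiff_const.mul contDiff_sin).add
      (contDiff_const.mul (contDiff_sin.pow 3))).div_const 4

lemma cubicInv_orbit (t : ℝ) : cubicInv (orbit t 1) = sin t := cubicInv_cubic (sin t)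

/-- The first coordinate is `cos t * (2 + sin t ^ 2)`; square it. -/
lemma orbitEqn_orbit (t : ℝ) : orbitEqn (orbit t 0) (sin t) = 0 := by
  have h : orbit t 0 = 3 * cos t - cos t ^ 3 := rfl
  rw [h, orbitEqn, sin_sq]
  ring

lemma isEntireSolution_orbit : IsEntireSolution potential orbit := by
  refine ⟨contDiff_orbit, fun t => ?_⟩
  have h0 : orbit t 0 = cos t * (2 + sin t ^ 2) := by
    rw [sin_sq]
    simp only [orbit]
    simp
    ring
  have h1 : (1 + 4 * sin t ^ 2) ≠ 0 := by positivity
  have h2 : (2 + sin t ^ 2) ≠ 0 := by positivity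
  rw [deriv_deriv_orbit, gradient_potential, potentialFst, potentialSndQuot, cubicInv_orbit,
    orbitEqn_orbit, h0]
  ext i
  fin_cases i
  · simp
    field_simp
  · simp
    field_simp
    ring

lemma isBounded_range_orbit : Bornology.IsBounded (Set.range orbit) := by
  have hper : Function.Periodic orbit (2 * π) := fun t => by simp [orbit]
  exact hper.isBounded_of_continuous two_pi_pos.ne' contDiff_orbit.continuous

theorem mainTheorem5 :
    ∃ (W : Plane → ℝ) (u : ℝ → Plane) (T : ℝ),
      IsSymmetricDoubleWell W ∧
      IsEntireSolution W u ∧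
      0 < T ∧ (∀ x : ℝ, u (x + T) = u x) ∧
      u 0 = wellPlus ∧ u (T / 2) = wellMinus ∧
      deriv u 0 ≠ 0 ∧ deriv u (T / 2) ≠ 0 ∧
      Bornology.IsBounded (Set.range u) ∧
      (¬ ∃ c : Plane, ∀ x : ℝ, u x = c) ∧
      (1 / 2 : ℝ) * ‖deriv u 0‖ ^ 2 > W (u 0) ∧
      (1 / 2 : ℝ) * ‖deriv u (T / 2)‖ ^ 2 > W (u (T / 2)) ∧
      ¬ ModicaEstimate W u ∧
      ¬ LiouvilleTheorem W := by
  have hT : 2 * π / 2 = π := by ring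
  have hW := isSymmetricDoubleWell_potential
  have h0 : orbit 0 = wellPlus := by
    simp [orbit, wellPlus]
    norm_num
  have h1 : orbit π = wellMinus := by
    simp [orbit, wellMinus]
    norm_num
  have hd0 : deriv orbit 0 ≠ 0 := fun h => by
    have := congrArg (fun p : Plane => p 1) h
    simp [deriv_orbit] at this
  have hd1 : deriv orbit π ≠ 0 := fun h => by
    have := congrArg (fun p : Plane => p 1) h
    simp [deriv_orbit] at this
  have hnc : ¬ ∃ c : Plane, ∀ x : ℝ, orbit x = c := by
    rintro ⟨c, hc⟩
    refine hd0 ?_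
    rw [show orbit = fun _ => c from funext hc]
    simp
  have hm0 : (1 / 2 : ℝ) * ‖deriv orbit 0‖ ^ 2 > potential (orbit 0) := by
    rw [h0, hW.zero_plus]
    have := norm_pos_iff.mpr hd0
    positivity
  have hm1 : (1 / 2 : ℝ) * ‖deriv orbit π‖ ^ 2 > potential (orbit π) := by
    rw [h1, hW.zero_minus]
    have := norm_pos_iff.mpr hd1
    positivity
  refine ⟨potential, orbit, 2 * π, hW, isEntireSolution_orbit, two_pi_pos,
    fun x => by simp [orbit], h0, ?_⟩
  rw [hT]
  exact ⟨h1, hd0, hd1, isBounded_range_orbit, hnc, hm0, hm1,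
    fun h => (h 0).not_gt hm0,
    fun h => hnc (h orbit isEntireSolution_orbit isBounded_range_orbit
      ⟨0, by rw [h0, hW.zero_plus]⟩)⟩
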